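/- Let $p>1$. For finite Borel measures $\mu,\nu$ on $\mathbb R$ of equal mass put $$W_p^p(\mu,\nu)=\inf_\pi\iint|x-y|^p\,d\pi(x,y),$$ where $\pi$ ranges over the nonnegative Borel measures on $\mathbb R\times\mathbb R$ with marginals $\mu$ and $\nu$. Let $\mathsf A=\{\rho\in L^1(\mathbb R):0\le\rho\le1 \text{ a.e.},\ \int\rho\,dx=1\}$ and, for $\rho\in\mathsf A$, let $$\mathcal W_p(\rho)=\inf\Big\{W_p(\rho\,dx,\rho'\,dx):\ \rho'\in L^1(\mathbb R),\ \rho'\ge0,\ \rho+\rho'\le1 \text{ a.e.},\ \int\rho'\,dx=\int\rho\,dx\Big\},$$ $$A(\rho)=\inf\big\{\|\rho-\chi_I\|_{L^1(\mathbb R)}:\ I\subset\mathbb R\text{ an open interval of length }1\big\}.$$ For an open interval $B$ of length $1$ write $\mathcal W_p(B)=\mathcal W_p(\chi_B)$. Then $\mathcal W_p(\rho)<\infty$ for every $\rho\in\mathsf A$, and: (i) there is a constant $C_p>0$, depending only on $p$, such that for every $\rho\in\mathsf A$ and every open interval $B$ of length $1$, $$\mathcal W_p^p(B)-\mathcal W_p^p(\rho)\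 \ge\ C_p\,A(\rho)^2;$$ (ii) the exponent $2$ is sharp: for every open interval $B$ of length $1$, every real $q<2$, every $c>0$ and every $\delta>0$ there is $\rho\in\mathsf A$ with $0<A(\rho)<\delta$ and $$\mathcal W_p^p(B)-\mathcal W_p^p(\rho)\ <\ c\,A(\rho)^q.$$ -/

import Mathlib

open MeasureTheory
open scoped ENNReal

noncomputable section

/-- The `p`-th power `W_p^p(μ, ν)` of the Wasserstein distance: the infimum of
`∬ d(x, y)^p dπ(x, y)` over all plans `π` with marginals `μ` and `ν`, with values in `[0, ∞]`. -/
def transportCost {X : Type*} [MetricSpace X] [MeasurableSpace X]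
    (p : ℝ) (μ ν : Measure X) : ℝ≥0∞ :=
  ⨅ π ∈ {π : Measure (X × X) | π.map Prod.fst = μ ∧ π.map Prod.snd = ν},
    ∫⁻ z, edist z.1 z.2 ^ p ∂π

/-- The Wasserstein distance `W_p(μ, ν)`. -/
def wassersteinDist {X : Type*} [MetricSpace X] [MeasurableSpace X]
    (p : ℝ) (μ ν : Measure X) : ℝ≥0∞ :=
  transportCost p μ ν ^ (1 / p)

/-- The measure with density `ρ` with respect to the reference measure. -/
def densityMeasure {X : Type*} [MeasureSpace X] (ρ : X → ℝ) : Measure X :=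
  (volume : Measure X).withDensity fun x => ENNReal.ofReal (ρ x)

/-- The class of admissible densities of mass `m`: the functions `ρ ∈ L¹` with `0 ≤ ρ ≤ 1`
almost everywhere and `∫ ρ = m`. -/
def admissibleDensities (X : Type*) [MeasureSpace X] (m : ℝ) : Set (X → ℝ) :=
  {ρ | Integrable ρ ∧ (∀ᵐ x, 0 ≤ ρ x) ∧ (∀ᵐ x, ρ x ≤ 1) ∧ ∫ x, ρ x = m}

/-- The Wasserstein energy of a density `ρ`: the infimum of `W_p(ρ, ρ')` over all densities
`ρ' ≥ 0` with `ρ + ρ' ≤ 1` and `∫ ρ' = ∫ ρ`. -/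
def wassersteinEnergy {X : Type*} [MetricSpace X] [MeasureSpace X]
    (p : ℝ) (ρ : X → ℝ) : ℝ≥0∞ :=
  ⨅ ρ' ∈ {ρ' : X → ℝ | Integrable ρ' ∧ (∀ᵐ x, 0 ≤ ρ' x) ∧ (∀ᵐ x, ρ x + ρ' x ≤ 1) ∧
      ∫ x, ρ' x = ∫ x, ρ x},
    wassersteinDist p (densityMeasure ρ) (densityMeasure ρ')

/-- The characteristic function of the open ball of centre `x` and radius `r`. -/
def ballDensity {X : Type*} [MetricSpace X] (x : X) (r : ℝ) : X → ℝ :=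
  (Metric.ball x r).indicator fun _ => 1

/-- The asymmetry of `ρ`: its `L¹` distance to the characteristic functions of balls of unit
measure. -/
def asymmetry {X : Type*} [MetricSpace X] [MeasureSpace X] (ρ : X → ℝ) : ℝ :=
  sInf {d : ℝ | ∃ (x : X) (r : ℝ), volume (Metric.ball x r) = 1 ∧
    d = ∫ y, |ρ y - ballDensity x r y|}

end

/-!
The energy of the unit interval `B` is `W_p^p(B) = (1/2)^p`, each half of `B` moving outwards by
`1/2`.

*Upper bounds.* Write `μ = ρ dx` and `ν = (1 - ρ) dx`, so that `μ + ν` is Lebesgue measure. By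
`wassersteinEnergy_rpow_le` it suffices to transport `μ` onto some measure below `ν`, which may be
done in pieces on disjoint sets. Cut the line at a median `t` of `μ` and let the mass to the right
of `t` be served to the right, first in first out, by the free space. The mass at `x` then travels at
most `1/2 - D x`, where `D x` is the mass served before `x` (`transportsInto_Ioi`); this already
bounds the energy by `(1/2)^p`. Let `ε` be the mass beyond `t + 1/2`, which is also the free space in
`(t, t + 1/2)`. If half of that space is used, then the mass `ε` beyond saves `ε/2` each, a gain of
order `ε^2`. Otherwise much of it comes before the mass that could use it: a mass of order `ε` next
to `t` lives where at least half of the space is free, and is absorbed there within intervals of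
length at most `1/2`. All the remaining mass then travels less by that amount, and the gain is of
order `ε` (`transportsInto_Ioi_half`). The left half is the mirror image. The interval of length one
around `t` has `L¹` distance `2 * (ε_left + ε_right)` from `ρ`, which bounds the asymmetry.

*Lower bounds.* For any plan, `t^p` is bounded below by its tangent line at `1/2`, and the mean
displacement by Kantorovich duality with the `1`-Lipschitz potential `φ y = (1 - |y - c|)⁺`; since
`φ ≥ 0`, a competitor `ρ'` integrates `φ` to at most `∫ φ (1 - ρ)` (`le_wassersteinEnergy_rpow`). This
gives the exact energy of `B`. If the last piece of `B` of length `ε` is shifted by `ε`, then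
`∫ φ ρ` drops by `ε^2` only, whereas the asymmetry lies between `ε` and `2 * ε`, so the exponent `2`
cannot be lowered.
-/

/-! ### First-in-first-out evacuation of a distribution function -/

/-- The cumulative amount of free space occupied when mass with distribution function `F` (and
density at most one) is served to the right, first in first out, by the free space, whose
distribution function is `x - F x`. Here `⨅ u ≤ x, (2 * F u - u)` is the running infimum of the
net input, so that `F x - fifoOutput F x` is the length of the queue at `x`. -/
noncomputable def fifoOutput (F : ℝ → ℝ) (x : ℝ) : ℝ :=
  x - F x + ⨅ u : Set.Iic x, (2 * F u - u)

/-- The place to which the first-in-first-out service sends the mass at `x`: the first point `y`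
to the right of `x` at which the free space has absorbed all the mass up to `x`. -/
noncomputable def fifoTarget (F : ℝ → ℝ) (x : ℝ) : ℝ :=
  sInf {y | x ≤ y ∧ F x ≤ fifoOutput F y}

/-- `F` is the distribution function of a measure of mass at most `m` on the line whose density is
at most one. -/
structure IsSlowDistribution (F : ℝ → ℝ) (m : ℝ) : Prop where
  nonneg : ∀ x, 0 ≤ F x
  mono : Monotone F
  sub_le : ∀ x y, x ≤ y → F y - F x ≤ y - x
  le : ∀ x, F x ≤ m

lemma continuous_of_monotone_of_sub_le {H : ℝ → ℝ} (hmono : Monotone H)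
    (hL : ∀ x y, x ≤ y → H y - H x ≤ y - x) : Continuous H := by
  refine (LipschitzWith.of_le_add fun x y => ?_).continuous
  rcases le_total x y with h | h
  · have := hmono h
    have := dist_nonneg (x := x) (y := y)
    linarith
  · have := hL y x h
    rw [Real.dist_eq, abs_of_nonneg (by linarith)]
    linarith

section Fifo

variable {F : ℝ → ℝ} {m : ℝ}

lemma bddBelow_netInput (hF : IsSlowDistribution F m) (x : ℝ) :
    BddBelow (Set.range fun u : Set.Iic x => 2 * F u - u) :=
  ⟨-x, by rintro _ ⟨⟨u, hu⟩, rfl⟩; have := hF.nonneg u; simp only [Set.mem_Iic] at hu ⊢; linarith⟩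

lemma fifoOutput_le_of_le (hF : IsSlowDistribution F m) {u x : ℝ} (h : u ≤ x) :
    fifoOutput F x ≤ x - F x + (2 * F u - u) := by
  have := ciInf_le (bddBelow_netInput hF x) ⟨u, h⟩
  simp only [fifoOutput] at this ⊢
  linarith

lemma le_fifoOutput {x c : ℝ} (h : ∀ u ≤ x, c ≤ x - F x + (2 * F u - u)) :
    c ≤ fifoOutput F x := by
  have : c - (x - F x) ≤ ⨅ u : Set.Iic x, (2 * F u - u) := by
    have : Nonempty (Set.Iic x) := ⟨⟨x, Set.mem_Iic.2 le_rfl⟩⟩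
    refine le_ciInf fun u => ?_
    have := h u u.2
    linarith
  unfold fifoOutput
  linarith

lemma fifoOutput_le (hF : IsSlowDistribution F m) (x : ℝ) : fifoOutput F x ≤ F x := by
  have := fifoOutput_le_of_le hF (le_refl x)
  linarith

lemma fifoOutput_nonneg (hF : IsSlowDistribution F m) (x : ℝ) :
    0 ≤ fifoOutput F x :=
  le_fifoOutput fun u hu => by have := hF.sub_le u x hu; have := hF.nonneg u; linarith

lemma fifoOutput_mono (hF : IsSlowDistribution F m) : Monotone (fifoOutput F) := by
  intro x y hxy
  refine le_fifoOutput fun u hu => ?_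
  rcases le_total u x with h | h
  · have := fifoOutput_le_of_le hF h
    have := hF.sub_le x y hxy
    linarith
  · have := fifoOutput_le hF x
    have := hF.mono h
    have := hF.sub_le u y hu
    linarith

/-- On every interval the service uses at most the free space there. -/
lemma fifoOutput_sub_le (hF : IsSlowDistribution F m) {x y : ℝ} (hxy : x ≤ y) :
    fifoOutput F y - fifoOutput F x ≤ (y - x) - (F y - F x) := by
  have : fifoOutput F y - ((y - x) - (F y - F x)) ≤ fifoOutput F x :=
    le_fifoOutput fun u hu => by
      have := fifoOutput_le_of_le hF (hu.trans hxy)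
      linarith
  linarith

lemma continuous_fifoOutput (hF : IsSlowDistribution F m) : Continuous (fifoOutput F) :=
  continuous_of_monotone_of_sub_le (fifoOutput_mono hF) fun x y hxy => by
    have := fifoOutput_sub_le hF hxy
    have := hF.mono hxy
    linarith

/-- By the distance `m - fifoOutput F x` to the right of `x` all the mass up to `x` has been served:
the stretch that the mass at `x` crosses consists of free space taken by the queue at `x` and of
mass beyond `x`, and together these are at most the total mass `m` minus what was served
before `x`. -/
lemma le_fifoOutput_add (hF : IsSlowDistribution F m) (x : ℝ) :
    F x ≤ fifoOutput F (x + (m - fifoOutput F x)) := by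
  have hD := fifoOutput_le hF x
  have hmx := hF.le x
  set y := x + (m - fifoOutput F x) with hy
  refine le_fifoOutput fun u hu => ?_
  rcases le_total x u with h | h
  · have := hF.mono h
    have := hF.sub_le u y hu
    linarith
  · have := fifoOutput_le_of_le hF h
    have := hF.le y
    linarith

lemma bddBelow_fifoTarget (x : ℝ) : BddBelow {y | x ≤ y ∧ F x ≤ fifoOutput F y} :=
  ⟨x, fun _ hy => hy.1⟩

lemma add_mem_fifoTarget (hF : IsSlowDistribution F m) (x : ℝ) :
    x + (m - fifoOutput F x) ∈ {y | x ≤ y ∧ F x ≤ fifoOutput F y} :=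
  ⟨by have := fifoOutput_le hF x; have := hF.le x; linarith, le_fifoOutput_add hF x⟩

lemma fifoTarget_le_add (hF : IsSlowDistribution F m) (x : ℝ) :
    fifoTarget F x ≤ x + (m - fifoOutput F x) :=
  csInf_le (bddBelow_fifoTarget x) (add_mem_fifoTarget hF x)

lemma le_fifoTarget (hF : IsSlowDistribution F m) (x : ℝ) : x ≤ fifoTarget F x :=
  le_csInf ⟨_, add_mem_fifoTarget hF x⟩ fun _ hy => hy.1

lemma fifoTarget_le_iff (hF : IsSlowDistribution F m) (x y : ℝ) :
    fifoTarget F x ≤ y ↔ x ≤ y ∧ F x ≤ fifoOutput F y := by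
  have hc : IsClosed {y | x ≤ y ∧ F x ≤ fifoOutput F y} :=
    (isClosed_le continuous_const continuous_id).inter
      (isClosed_le continuous_const (continuous_fifoOutput hF))
  have hmem := hc.csInf_mem ⟨_, add_mem_fifoTarget hF x⟩ (bddBelow_fifoTarget x)
  refine ⟨fun h => ?_, fun h => csInf_le (bddBelow_fifoTarget x) h⟩
  exact ⟨hmem.1.trans h, hmem.2.trans (fifoOutput_mono hF h)⟩

lemma fifoTarget_mono (hF : IsSlowDistribution F m) : Monotone (fifoTarget F) := by
  intro x y hxy
  refine csInf_le_csInf (bddBelow_fifoTarget x) ⟨_, add_mem_fifoTarget hF y⟩ ?_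
  exact fun z hz => ⟨hxy.trans hz.1, (hF.mono hxy).trans hz.2⟩

end Fifo

/-! ### The service of a measure bounded by Lebesgue measure -/

lemma le_volume_of_add_eq {μ ν : Measure ℝ} (h : μ + ν = volume) : μ ≤ volume := by
  rw [← h]; exact Measure.le_add_right le_rfl

section Service

variable {μ ν : Measure ℝ} [IsFiniteMeasure μ]

lemma measureReal_Iic_mono : Monotone fun x => μ.real (Set.Iic x) :=
  fun _ _ h => measureReal_mono (Set.Iic_subset_Iic.2 h)

lemma measureReal_Iic_sub (x y : ℝ) (hxy : x ≤ y) :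
    μ.real (Set.Iic y) - μ.real (Set.Iic x) = μ.real (Set.Ioc x y) := by
  rw [← Set.Iic_sdiff_Iic, measureReal_sdiff (Set.Iic_subset_Iic.2 hxy) measurableSet_Iic]

lemma measureReal_Iic_sub_le (hμ : μ ≤ volume) (x y : ℝ) (hxy : x ≤ y) :
    μ.real (Set.Iic y) - μ.real (Set.Iic x) ≤ y - x := by
  rw [measureReal_Iic_sub x y hxy]
  have := ENNReal.toReal_mono (by simp) (hμ (Set.Ioc x y))
  simpa [Measure.real, hxy] using this

lemma continuous_measureReal_Iic (hμ : μ ≤ volume) : Continuous fun x => μ.real (Set.Iic x) :=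
  continuous_of_monotone_of_sub_le measureReal_Iic_mono (measureReal_Iic_sub_le hμ)

lemma tendsto_measureReal_Iic_atBot :
    Filter.Tendsto (fun x => μ.real (Set.Iic x)) Filter.atBot (nhds 0) := by
  have h := tendsto_measure_iInter_atBot (μ := μ) (s := fun x : ℝ => Set.Iic x)
    (fun _ => measurableSet_Iic.nullMeasurableSet) (fun _ _ h => Set.Iic_subset_Iic.2 h)
    ⟨0, measure_ne_top _ _⟩
  have he : (⋂ x : ℝ, Set.Iic x) = ∅ := by
    ext z
    simp only [Set.mem_iInter, Set.mem_Iic, Set.mem_empty_iff_false, iff_false, not_forall, not_le]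
    exact exists_lt z
  rw [he, measure_empty] at h
  simpa [Measure.real, Function.comp_def] using (ENNReal.tendsto_toReal ENNReal.zero_ne_top).comp h

lemma tendsto_measureReal_Iic_atTop :
    Filter.Tendsto (fun x => μ.real (Set.Iic x)) Filter.atTop (nhds (μ.real Set.univ)) := by
  have h := tendsto_measure_iUnion_atTop (μ := μ) (s := fun x : ℝ => Set.Iic x)
    (fun _ _ h => Set.Iic_subset_Iic.2 h)
  rw [Set.iUnion_Iic] at h
  exact (ENNReal.tendsto_toReal (measure_ne_top _ _)).comp h

lemma exists_measureReal_Iic_eq (hμ : μ ≤ volume) {c : ℝ} (hc : 0 < c) {y : ℝ}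
    (hy : c ≤ μ.real (Set.Iic y)) : ∃ z ≤ y, μ.real (Set.Iic z) = c := by
  obtain ⟨x, hx⟩ := ((tendsto_measureReal_Iic_atBot (μ := μ)).eventually_lt_const hc).exists
  have hxy : x ≤ y := by
    by_contra! h
    exact absurd (measureReal_Iic_mono (μ := μ) h.le) (by simp only; linarith)
  obtain ⟨z, hz, hzc⟩ := intermediate_value_Icc hxy (continuous_measureReal_Iic hμ).continuousOn
    ⟨hx.le, hy⟩
  exact ⟨z, hz.2, hzc⟩

/-- A continuous distribution function pushes its measure to Lebesgue measure. -/
lemma measureReal_Iic_inter_sublevel (hμ : μ ≤ volume) {c y : ℝ} (hc : 0 ≤ c)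
    (hy : c ≤ μ.real (Set.Iic y)) : μ.real {x | x ≤ y ∧ μ.real (Set.Iic x) ≤ c} = c := by
  apply le_antisymm
  · rcases Set.eq_empty_or_nonempty {x | x ≤ y ∧ μ.real (Set.Iic x) ≤ c} with he | hne
    · rw [he]; simpa using hc
    · have hcl : IsClosed {x | x ≤ y ∧ μ.real (Set.Iic x) ≤ c} :=
        (isClosed_le continuous_id continuous_const).inter
          (isClosed_le (continuous_measureReal_Iic hμ) continuous_const)
      have hb : BddAbove {x | x ≤ y ∧ μ.real (Set.Iic x) ≤ c} := ⟨y, fun _ h => h.1⟩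
      have hmem := hcl.csSup_mem hne hb
      refine (measureReal_mono (fun x hx => ?_)).trans hmem.2
      exact le_csSup hb hx
  · rcases hc.eq_or_lt with rfl | hc
    · exact measureReal_nonneg
    · obtain ⟨z, hz, hzc⟩ := exists_measureReal_Iic_eq hμ hc hy
      rw [← hzc]
      refine measureReal_mono fun x hx => ⟨le_trans hx hz, ?_⟩
      exact measureReal_Iic_mono hx

lemma isSlowDistribution_measureReal_Iic (hμ : μ ≤ volume) :
    IsSlowDistribution (fun x => μ.real (Set.Iic x)) (μ.real Set.univ) where
  nonneg _ := measureReal_nonneg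
  mono := measureReal_Iic_mono
  sub_le := measureReal_Iic_sub_le hμ
  le _ := measureReal_mono (Set.subset_univ _)

/-- First in first out transport moves a measure below Lebesgue measure into its complement. -/
lemma map_fifoTarget_le (h : μ + ν = volume) :
    μ.map (fifoTarget fun x => μ.real (Set.Iic x)) ≤ ν := by
  have hμ : μ ≤ volume := le_volume_of_add_eq h
  set F := fun x => μ.real (Set.Iic x) with hF
  have hS : IsSlowDistribution F (μ.real Set.univ) := isSlowDistribution_measureReal_Iic hμ
  have hT : Measurable (fifoTarget F) := (fifoTarget_mono hS).measurable
  have hTI : ∀ y, (μ.map (fifoTarget F)).real (Set.Iic y) = fifoOutput F y := by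
    intro y
    rw [Measure.real, Measure.map_apply hT measurableSet_Iic]
    have : fifoTarget F ⁻¹' Set.Iic y = {x | x ≤ y ∧ F x ≤ fifoOutput F y} := by
      ext x; exact fifoTarget_le_iff hS x y
    rw [this]
    exact measureReal_Iic_inter_sublevel hμ (fifoOutput_nonneg hS y) (fifoOutput_le hS y)
  -- the free space that is left over
  let K : StieltjesFunction ℝ :=
    { toFun := fun x => x - F x - fifoOutput F x
      mono' := fun x y hxy => by have := fifoOutput_sub_le hS hxy; simp only; linarith
      right_continuous' := fun x => (((continuous_id.sub (continuous_measureReal_Iic hμ)).sub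
        (continuous_fifoOutput hS)).continuousWithinAt) }
  have hKdef : ∀ x, K x = x - F x - fifoOutput F x := fun _ => rfl
  have hsum : volume = μ.map (fifoTarget F) + K.measure + μ := by
    refine Measure.ext_of_Ioc _ _ fun a b hab => ?_
    simp only [Measure.add_apply, StieltjesFunction.measure_Ioc, Real.volume_Ioc]
    rw [← ofReal_measureReal (μ := μ), ← ofReal_measureReal (μ := μ.map _),
      ← measureReal_Iic_sub a b hab.le, ← measureReal_Iic_sub a b hab.le, hTI, hTI,
      ← ENNReal.ofReal_add, ← ENNReal.ofReal_add]
    · congr 1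
      rw [hKdef, hKdef]
      simp only [hF]; ring
    · have := K.mono hab.le
      have := fifoOutput_mono hS hab.le
      linarith
    · have := hS.mono hab.le
      simp only [hF] at this ⊢; linarith
    · have := fifoOutput_mono hS hab.le
      linarith
    · have := K.mono hab.le
      linarith
  rw [← h, add_comm μ ν] at hsum
  refine Measure.le_iff.2 fun s _ => ?_
  have hs := congrArg (fun κ : Measure ℝ => κ s) hsum
  simp only [Measure.add_apply] at hs
  rw [(ENNReal.add_left_inj (measure_ne_top μ s)).1 hs]
  exact le_self_add

end Service

/-! ### Transport into available space -/

/-- The measure `μ` can be transported into the space offered by `ν`, that is, onto some measure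
below `ν`, at `p`-cost at most `c`. -/
def TransportsInto (p : ℝ) (μ ν : Measure ℝ) (c : ℝ≥0∞) : Prop :=
  ∃ π : Measure (ℝ × ℝ), π.map Prod.fst = μ ∧ π.map Prod.snd ≤ ν ∧
    ∫⁻ z, edist z.1 z.2 ^ p ∂π ≤ c

section Transport

variable {p : ℝ} {μ ν μ' ν' : Measure ℝ} {c c' : ℝ≥0∞}

lemma TransportsInto.add (h : TransportsInto p μ ν c) (h' : TransportsInto p μ' ν' c') :
    TransportsInto p (μ + μ') (ν + ν') (c + c') := by
  obtain ⟨π, h1, h2, h3⟩ := h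
  obtain ⟨π', h1', h2', h3'⟩ := h'
  refine ⟨π + π', ?_, ?_, ?_⟩
  · rw [Measure.map_add _ _ measurable_fst, h1, h1']
  · rw [Measure.map_add _ _ measurable_snd]
    exact add_le_add h2 h2'
  · rw [lintegral_add_measure]
    exact add_le_add h3 h3'

lemma TransportsInto.mono (h : TransportsInto p μ ν c) (hc : c ≤ c') :
    TransportsInto p μ ν c' := by
  obtain ⟨π, h1, h2, h3⟩ := h
  exact ⟨π, h1, h2, h3.trans hc⟩

lemma TransportsInto.map_neg (h : TransportsInto p μ ν c) :
    TransportsInto p (μ.map Neg.neg) (ν.map Neg.neg) c := by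
  obtain ⟨π, h1, h2, h3⟩ := h
  have hm : Measurable fun z : ℝ × ℝ => (-z.1, -z.2) := by fun_prop
  refine ⟨π.map fun z => (-z.1, -z.2), ?_, ?_, ?_⟩
  · rw [← h1, Measure.map_map measurable_fst hm, Measure.map_map measurable_neg measurable_fst]
    rfl
  · rw [Measure.map_map measurable_snd hm]
    refine le_trans (le_of_eq ?_) (Measure.map_mono h2 measurable_neg)
    rw [Measure.map_map measurable_neg measurable_snd]
    rfl
  · rw [lintegral_map (by fun_prop) hm]
    simpa [edist_neg_neg] using h3

lemma TransportsInto.union {s t : Set ℝ} (hd : Disjoint s t) (ht : MeasurableSet t)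
    (h : TransportsInto p (μ.restrict s) (ν.restrict s) c)
    (h' : TransportsInto p (μ.restrict t) (ν.restrict t) c') :
    TransportsInto p (μ.restrict (s ∪ t)) (ν.restrict (s ∪ t)) (c + c') := by
  rw [Measure.restrict_union hd ht, Measure.restrict_union hd ht]
  exact h.add h'

lemma transportsInto_zero : TransportsInto p 0 ν c :=
  ⟨0, by simp, by simpa using Measure.zero_le ν, by simp⟩

/-- In a bounded set that offers enough space, any coupling will do: the normalised product. -/
lemma transportsInto_of_diam_le [IsFiniteMeasure μ] [IsFiniteMeasure ν] (hp : 0 ≤ p) {s : Set ℝ}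
    (hμ : μ sᶜ = 0) (hν : ν sᶜ = 0) {L : ℝ≥0∞}
    (hL : ∀ x ∈ s, ∀ y ∈ s, edist x y ≤ L) (h : μ Set.univ ≤ ν Set.univ) :
    TransportsInto p μ ν (L ^ p * μ Set.univ) := by
  rcases eq_or_ne (ν Set.univ) 0 with h0 | h0
  · have : μ = 0 := Measure.measure_univ_eq_zero.1 (le_antisymm (h.trans h0.le) zero_le)
    rw [this]
    exact transportsInto_zero
  · have hν1 : (ν Set.univ)⁻¹ * ν Set.univ = 1 := ENNReal.inv_mul_cancel h0 (measure_ne_top _ _)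
    have hle : (ν Set.univ)⁻¹ * μ Set.univ ≤ 1 := by
      rw [← hν1]; gcongr
    refine ⟨(ν Set.univ)⁻¹ • μ.prod ν, ?_, ?_, ?_⟩
    · rw [Measure.map_smul, Measure.map_fst_prod, smul_smul, hν1, one_smul]
    · rw [Measure.map_smul, Measure.map_snd_prod, smul_smul]
      intro t
      simpa using mul_le_mul_left hle (ν t)
    · rw [lintegral_smul_measure]
      have hae : ∀ᵐ z ∂μ.prod ν, edist z.1 z.2 ^ p ≤ L ^ p := by
        have h1 : ∀ᵐ z ∂μ.prod ν, z.1 ∈ s := Measure.quasiMeasurePreserving_fst.ae hμ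
        have h2 : ∀ᵐ z ∂μ.prod ν, z.2 ∈ s := Measure.quasiMeasurePreserving_snd.ae hν
        filter_upwards [h1, h2] with z hz1 hz2
        exact ENNReal.rpow_le_rpow (hL _ hz1 _ hz2) hp
      refine (mul_le_mul_right (lintegral_mono_ae hae) _).trans (le_of_eq ?_)
      rw [lintegral_const, ← Set.univ_prod_univ, Measure.prod_prod]
      calc _ = L ^ p * μ Set.univ * ((ν Set.univ)⁻¹ * ν Set.univ) := by ring
        _ = _ := by rw [hν1, mul_one]

end Transport

section HalfLine

variable {p : ℝ} {μ ν : Measure ℝ} [IsFiniteMeasure μ]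

lemma transportsInto_Ioc (hp : 0 ≤ p) (h : μ + ν = volume) {a b L : ℝ} (hL : b - a ≤ L)
    (hab : a ≤ b) (hm : μ.real (Set.Ioc a b) ≤ (b - a) / 2) :
    TransportsInto p (μ.restrict (Set.Ioc a b)) (ν.restrict (Set.Ioc a b))
      (ENNReal.ofReal (L ^ p * μ.real (Set.Ioc a b))) := by
  have hvol : μ (Set.Ioc a b) + ν (Set.Ioc a b) = ENNReal.ofReal (b - a) := by
    rw [← Measure.add_apply, h, Real.volume_Ioc]
  have hνfin : ν (Set.Ioc a b) ≠ ∞ := fun ht => by simp [ht] at hvol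
  have : IsFiniteMeasure (ν.restrict (Set.Ioc a b)) := ⟨by simpa using hνfin.lt_top⟩
  have key := transportsInto_of_diam_le (μ := μ.restrict (Set.Ioc a b))
    (ν := ν.restrict (Set.Ioc a b)) hp (s := Set.Ioc a b) (L := ENNReal.ofReal L)
    (by simp [Measure.restrict_apply]) (by simp [Measure.restrict_apply])
    (fun x hx y hy => by
      rw [edist_dist]
      refine ENNReal.ofReal_le_ofReal ?_
      rw [Real.dist_eq, abs_le]
      constructor <;> linarith [hx.1, hx.2, hy.1, hy.2])
    (by
      simp only [Measure.restrict_apply_univ]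
      rw [← ENNReal.toReal_le_toReal (measure_ne_top _ _) hνfin]
      have := congrArg ENNReal.toReal hvol
      rw [ENNReal.toReal_add (measure_ne_top _ _) hνfin, ENNReal.toReal_ofReal (by linarith)]
        at this
      simp only [Measure.real] at hm
      linarith)
  refine key.mono (le_of_eq ?_)
  have hL0 : 0 ≤ L := by linarith
  rw [Measure.restrict_apply_univ, ENNReal.ofReal_mul (by positivity), ofReal_measureReal,
    ENNReal.ofReal_rpow_of_nonneg hL0 hp]

/-- A long interval which contains little mass is cut into short ones, each of which absorbs its
own mass. -/
lemma transportsInto_Ioc_nat_mul (hp : 0 ≤ p) (h : μ + ν = volume) {δ L : ℝ} (hδ : 0 ≤ δ)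
    (hL : δ ≤ L) (a : ℝ) (n : ℕ) (hm : μ.real (Set.Ioc a (a + n * δ)) ≤ δ / 2) :
    TransportsInto p (μ.restrict (Set.Ioc a (a + n * δ))) (ν.restrict (Set.Ioc a (a + n * δ)))
      (ENNReal.ofReal (L ^ p * μ.real (Set.Ioc a (a + n * δ)))) := by
  induction n with
  | zero => simpa using transportsInto_zero
  | succ n ih =>
    have h1 : a ≤ a + n * δ := le_add_of_nonneg_right (by positivity)
    have h2 : a + n * δ ≤ a + (n + 1 : ℕ) * δ := by push_cast; linarith
    have hU := Set.Ioc_union_Ioc_eq_Ioc h1 h2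
    have hd : Disjoint (Set.Ioc a (a + n * δ)) (Set.Ioc (a + n * δ) (a + (n + 1 : ℕ) * δ)) :=
      Set.Ioc_disjoint_Ioc_of_le le_rfl
    have hs1 : μ.real (Set.Ioc a (a + n * δ)) ≤ δ / 2 :=
      (measureReal_mono (Set.Ioc_subset_Ioc_right h2)).trans hm
    have hs2 : μ.real (Set.Ioc (a + n * δ) (a + (n + 1 : ℕ) * δ)) ≤ δ / 2 :=
      (measureReal_mono (Set.Ioc_subset_Ioc_left h1)).trans hm
    have hlen : a + (n + 1 : ℕ) * δ - (a + n * δ) = δ := by push_cast; ring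
    have key := (ih hs1).union hd measurableSet_Ioc
      (transportsInto_Ioc hp h (L := L) (by rw [hlen]; exact hL) h2 (by rw [hlen]; exact hs2))
    have hL0 : 0 ≤ L := hδ.trans hL
    rw [hU, ← ENNReal.ofReal_add (by positivity) (by positivity), ← mul_add,
      ← measureReal_union hd measurableSet_Ioc, hU] at key
    exact key

/-- First-in-first-out transport on a half-line. The displacement is at most the mass `m` of the
half-line, and at most `m - δ` beyond a point `a` before which the mass `δ` has been served. -/
lemma transportsInto_Ioi (hp : 0 ≤ p) (h : μ + ν = volume) (t a δ : ℝ) (hta : t ≤ a)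
    (hδ : δ ≤ fifoOutput (fun x => (μ.restrict (Set.Ioi t)).real (Set.Iic x)) a) :
    TransportsInto p (μ.restrict (Set.Ioi t)) (ν.restrict (Set.Ioi t))
      (ENNReal.ofReal (μ.real (Set.Ioi t) ^ p * μ.real (Set.Ioc t a)
        + (μ.real (Set.Ioi t) - δ) ^ p * μ.real (Set.Ioi a))) := by
  set μ' := μ.restrict (Set.Ioi t) with hμ'
  set m := μ.real (Set.Ioi t) with hm
  set F := fun x => μ'.real (Set.Iic x) with hF
  have hsum : μ' + (ν.restrict (Set.Ioi t) + volume.restrict (Set.Iic t)) = volume := by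
    rw [← add_assoc, hμ', ← Measure.restrict_add, h, ← Set.compl_Ioi,
      Measure.restrict_add_restrict_compl measurableSet_Ioi]
  have hm' : μ'.real Set.univ = m := by simp [hμ', hm, Measure.real]
  have hS : IsSlowDistribution F m := by
    rw [← hm']; exact isSlowDistribution_measureReal_Iic (le_volume_of_add_eq hsum)
  have hT : Measurable (fifoTarget F) := (fifoTarget_mono hS).measurable
  have hle := map_fifoTarget_le hsum
  have hpair : Measurable fun x => (x, fifoTarget F x) := measurable_id.prodMk hT
  have hmem : ∀ᵐ x ∂μ', x ∈ Set.Ioi t := ae_restrict_mem measurableSet_Ioi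
  refine ⟨μ'.map fun x => (x, fifoTarget F x), ?_, ?_, ?_⟩
  · rw [Measure.map_map measurable_fst hpair]
    exact Measure.map_id
  · rw [Measure.map_map measurable_snd hpair]
    change μ'.map (fifoTarget F) ≤ _
    have hsupp : (μ'.map (fifoTarget F)).restrict (Set.Ioi t) = μ'.map (fifoTarget F) := by
      refine Measure.restrict_eq_self_of_ae_mem ?_
      refine (ae_map_iff hT.aemeasurable measurableSet_Ioi).2 ?_
      filter_upwards [hmem] with x hx
      exact lt_of_lt_of_le hx (le_fifoTarget hS x)
    rw [← hsupp]
    refine (Measure.restrict_mono subset_rfl hle).trans (le_of_eq ?_)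
    rw [Measure.restrict_add, Measure.restrict_restrict measurableSet_Ioi,
      Measure.restrict_restrict measurableSet_Ioi, Set.inter_self, Set.Ioi_inter_Iic, Set.Ioc_self,
      Measure.restrict_empty, add_zero]
  · rw [lintegral_map (by fun_prop) hpair]
    have hdm : fifoOutput F a ≤ m := (fifoOutput_le hS a).trans (hS.le a)
    have hbound : ∀ x, edist x (fifoTarget F x) ≤ ENNReal.ofReal (m - fifoOutput F x) := by
      intro x
      rw [edist_dist]
      refine ENNReal.ofReal_le_ofReal ?_
      have h1 := le_fifoTarget hS x
      have h2 := fifoTarget_le_add hS x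
      rw [Real.dist_eq, abs_le]
      constructor <;> linarith
    rw [hμ', ← Set.Ioc_union_Ioi_eq_Ioi hta, lintegral_union measurableSet_Ioi
      (Set.Ioc_disjoint_Ioi le_rfl), ENNReal.ofReal_add (by positivity)
      (mul_nonneg (Real.rpow_nonneg (by linarith) _) measureReal_nonneg)]
    refine add_le_add ?_ ?_
    · rw [ENNReal.ofReal_mul (by positivity), ofReal_measureReal,
        ← ENNReal.ofReal_rpow_of_nonneg (by positivity) hp, ← setLIntegral_const]
      refine lintegral_mono fun x => ENNReal.rpow_le_rpow ((hbound x).trans ?_) hp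
      exact ENNReal.ofReal_le_ofReal (by linarith [fifoOutput_nonneg hS x])
    · rw [ENNReal.ofReal_mul (Real.rpow_nonneg (by linarith) _), ofReal_measureReal,
        ← ENNReal.ofReal_rpow_of_nonneg (by linarith) hp, ← setLIntegral_const]
      refine setLIntegral_mono measurable_const fun x hx =>
        ENNReal.rpow_le_rpow ((hbound x).trans ?_) hp
      exact ENNReal.ofReal_le_ofReal (by linarith [fifoOutput_mono hS (le_of_lt hx)])

end HalfLine

/-! ### The quantitative bound on a half-line -/

section HalfLineBound

variable {p : ℝ} {μ ν : Measure ℝ} [IsFiniteMeasure μ]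

lemma one_sub_rpow_le {p x : ℝ} (hp : 1 ≤ p) (h0 : 0 ≤ x) (h1 : x ≤ 1) : (1 - x) ^ p ≤ 1 - x := by
  have := Real.rpow_le_rpow_of_exponent_ge' (by linarith : 0 ≤ 1 - x) (by linarith) zero_le_one hp
  rwa [Real.rpow_one] at this

lemma half_sub_rpow_le {p x : ℝ} (hp : 1 ≤ p) (h0 : 0 ≤ x) (h1 : x ≤ 1 / 2) :
    (1 / 2 - x) ^ p ≤ (1 / 2) ^ p * (1 - 2 * x) := by
  have h : 1 / 2 - x = 1 / 2 * (1 - 2 * x) := by ring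
  rw [h, Real.mul_rpow (by norm_num) (by linarith)]
  exact mul_le_mul_of_nonneg_left (one_sub_rpow_le hp (by linarith) (by linarith)) (by positivity)

lemma measureReal_Ioc_add_Ioi {t s : ℝ} (hts : t ≤ s) :
    μ.real (Set.Ioc t s) + μ.real (Set.Ioi s) = μ.real (Set.Ioi t) := by
  rw [← measureReal_union (Set.Ioc_disjoint_Ioi le_rfl) measurableSet_Ioi,
    Set.Ioc_union_Ioi_eq_Ioi hts]

/-- If the mass `η` next to `t` can be absorbed by short intervals that contain it, then the rest
moves by at most `1 / 2 - η`, and the gain is linear in `η`. -/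
lemma transportsInto_Ioi_of_local (hp : 1 ≤ p) (h : μ + ν = volume) {t δ : ℝ}
    (hm : μ.real (Set.Ioi t) = 1 / 2) (hδ : 0 ≤ δ) (hδ2 : δ ≤ 1 / 2) (n : ℕ)
    (hη : μ.real (Set.Ioc t (t + n * δ)) ≤ δ / 2) :
    TransportsInto p (μ.restrict (Set.Ioi t)) (ν.restrict (Set.Ioi t))
      (ENNReal.ofReal ((1 / 2) ^ p * (1 / 2 - μ.real (Set.Ioc t (t + n * δ)) / 2))) := by
  have hts : t ≤ t + n * δ := le_add_of_nonneg_right (by positivity)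
  have h1 := transportsInto_Ioc_nat_mul (by linarith : 0 ≤ p) h hδ hδ2 t n hη
  set s := t + n * δ
  have hsum := measureReal_Ioc_add_Ioi (μ := μ) hts
  set η := μ.real (Set.Ioc t s)
  have hη0 : 0 ≤ η := measureReal_nonneg
  have hrest : μ.real (Set.Ioi s) = 1 / 2 - η := by linarith
  have h2 := transportsInto_Ioi (by linarith : 0 ≤ p) h s s 0 le_rfl
    (fifoOutput_nonneg (isSlowDistribution_measureReal_Iic
      (Measure.restrict_le_self.trans (le_volume_of_add_eq h))) s)
  have key := h1.union (Set.Ioc_disjoint_Ioi le_rfl) measurableSet_Ioi h2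
  rw [Set.Ioc_union_Ioi_eq_Ioi hts, hrest, Set.Ioc_self, measureReal_empty, mul_zero, zero_add,
    sub_zero, ← ENNReal.ofReal_add (by positivity)
    (mul_nonneg (Real.rpow_nonneg (by linarith) _) (by linarith))] at key
  refine key.mono (ENNReal.ofReal_le_ofReal ?_)
  have hr := half_sub_rpow_le hp hη0 (by linarith)
  have hM : 0 < (1 / 2 : ℝ) ^ p := by positivity
  calc (1 / 2) ^ p * η + (1 / 2 - η) ^ p * (1 / 2 - η)
      ≤ (1 / 2) ^ p * η + (1 / 2) ^ p * (1 - 2 * η) * (1 / 2 - η) := by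
        gcongr
        linarith
    _ = (1 / 2) ^ p * (1 / 2 - η / 2 - η * (1 / 2 - 2 * η)) := by ring
    _ ≤ (1 / 2) ^ p * (1 / 2 - η / 2) := by
        have : 0 ≤ η * (1 / 2 - 2 * η) := mul_nonneg hη0 (by linarith)
        exact mul_le_mul_of_nonneg_left (by linarith) hM.le

/-- A half-line of mass `1 / 2` is evacuated at cost `(1 / 2) ^ p * (1 / 2)`, up to a gain
quadratic in the mass `ε` that lies beyond the distance `1 / 2` from the end point. Either the
free space `ε` within that distance serves a mass `ε / 2` first in first out, and the mass `ε` beyond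
moves less; or that space comes before the mass, which can then be absorbed near the end point. -/
lemma transportsInto_Ioi_half (hp : 1 ≤ p) (h : μ + ν = volume) {t : ℝ}
    (hm : μ.real (Set.Ioi t) = 1 / 2) :
    TransportsInto p (μ.restrict (Set.Ioi t)) (ν.restrict (Set.Ioi t))
      (ENNReal.ofReal ((1 / 2) ^ p * (1 / 2 - μ.real (Set.Ioi (t + 1 / 2)) ^ 2 / 8))) := by
  have hμ := le_volume_of_add_eq h
  have hsum := measureReal_Ioc_add_Ioi (μ := μ) (by linarith : t ≤ t + 1 / 2)
  set ε := μ.real (Set.Ioi (t + 1 / 2))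
  have hε0 : 0 ≤ ε := measureReal_nonneg
  have hε1 : ε ≤ 1 / 2 := by
    have := measureReal_nonneg (μ := μ) (s := Set.Ioc t (t + 1 / 2))
    linarith
  have hM : 0 < (1 / 2 : ℝ) ^ p := by positivity
  have hμ' : μ.restrict (Set.Ioi t) ≤ volume := Measure.restrict_le_self.trans hμ
  have hFm : (μ.restrict (Set.Ioi t)).real Set.univ = 1 / 2 := by
    simpa [Measure.real] using hm
  have hFeq : ∀ x, (μ.restrict (Set.Ioi t)).real (Set.Iic x) = μ.real (Set.Ioc t x) := by
    intro x
    rw [Measure.real, Measure.restrict_apply measurableSet_Iic, Set.inter_comm, Set.Ioi_inter_Iic]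
    rfl
  have hS := isSlowDistribution_measureReal_Iic hμ'
  by_cases hD : ε / 2 ≤
      fifoOutput (fun x => (μ.restrict (Set.Ioi t)).real (Set.Iic x)) (t + 1 / 2)
  · refine (transportsInto_Ioi (by linarith : 0 ≤ p) h t (t + 1 / 2) (ε / 2) (by linarith)
      hD).mono (ENNReal.ofReal_le_ofReal ?_)
    have hr := half_sub_rpow_le hp (by linarith : 0 ≤ ε / 2) (by linarith)
    have hIoc : μ.real (Set.Ioc t (t + 1 / 2)) = 1 / 2 - ε := by linarith
    rw [hm, hIoc]
    calc (1 / 2) ^ p * (1 / 2 - ε) + (1 / 2 - ε / 2) ^ p * ε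
        ≤ (1 / 2) ^ p * (1 / 2 - ε) + (1 / 2) ^ p * (1 - 2 * (ε / 2)) * ε := by gcongr
      _ = (1 / 2) ^ p * (1 / 2 - ε ^ 2) := by ring
      _ ≤ (1 / 2) ^ p * (1 / 2 - ε ^ 2 / 8) := by gcongr; nlinarith [sq_nonneg ε]
  · have hD0 := fifoOutput_nonneg hS (t + 1 / 2)
    have hεpos : 0 < ε := by linarith
    obtain ⟨u, hut, hu⟩ : ∃ u ≤ t + 1 / 2, t + ε + 2 * μ.real (Set.Ioc t u) - u < ε / 2 := by
      by_contra! hcon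
      refine hD (le_fifoOutput fun u hu => ?_)
      have := hcon u hu
      rw [hFeq, hFeq]
      linarith
    have hu0 : 0 ≤ μ.real (Set.Ioc t u) := measureReal_nonneg
    -- the mass next to `t` to be absorbed is at least `ε / 8`
    obtain ⟨n, δ, hδ0, hδ1, hη1, hη2⟩ : ∃ (n : ℕ) (δ : ℝ), 0 ≤ δ ∧ δ ≤ 1 / 2 ∧
        μ.real (Set.Ioc t (t + n * δ)) ≤ δ / 2 ∧ ε / 8 ≤ μ.real (Set.Ioc t (t + n * δ)) := by
      obtain ⟨y, hy⟩ : ∃ y, ε / 8 < (μ.restrict (Set.Ioi t)).real (Set.Iic y) := by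
        refine ((tendsto_measureReal_Iic_atTop (μ := μ.restrict (Set.Ioi t))).eventually_const_lt
          ?_).exists
        rw [hFm]; linarith
      obtain ⟨s, -, hs⟩ := exists_measureReal_Iic_eq hμ' (by linarith : 0 < ε / 8) hy.le
      rw [hFeq] at hs
      rcases le_or_gt s u with hsu | hsu
      · refine ⟨1, u - t, by linarith, by linarith, ?_, ?_⟩
        · rw [Nat.cast_one, one_mul, add_sub_cancel]; linarith
        · rw [Nat.cast_one, one_mul, add_sub_cancel, ← hs]
          exact measureReal_mono (Set.Ioc_subset_Ioc_right hsu)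
      · rcases le_or_gt (s - t) (1 / 2) with hst | hst
        · refine ⟨1, s - t, by linarith, by linarith, ?_, ?_⟩
          · rw [Nat.cast_one, one_mul, add_sub_cancel]; linarith
          · rw [Nat.cast_one, one_mul, add_sub_cancel, ← hs]
        · -- cut into `n` intervals of length between `1 / 4` and `1 / 2`
          have hn1 := Nat.le_ceil (2 * (s - t))
          have hn2 := Nat.ceil_lt_add_one (by linarith : 0 ≤ 2 * (s - t))
          set n := ⌈2 * (s - t)⌉₊
          have hn0 : (0 : ℝ) < n := by linarith
          have hnδ : t + n * ((s - t) / n) = s := by rw [mul_div_cancel₀ _ hn0.ne']; ring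
          have h4 : 1 / 4 ≤ (s - t) / n := by rw [le_div_iff₀ hn0]; linarith
          refine ⟨n, (s - t) / n, by linarith, ?_, ?_, ?_⟩
          · rw [div_le_iff₀ hn0]; linarith
          · rw [hnδ, hs]; linarith
          · rw [hnδ, hs]
    refine (transportsInto_Ioi_of_local hp h hm hδ0 hδ1 n hη1).mono (ENNReal.ofReal_le_ofReal ?_)
    exact mul_le_mul_of_nonneg_left (by nlinarith) hM.le

end HalfLineBound

/-! ### The quantitative bound on the line -/

section Line

variable {p : ℝ} {μ ν : Measure ℝ}

/-- Reflection of the bound on right half-lines. -/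
lemma transportsInto_Iic_half [IsFiniteMeasure μ] (hp : 1 ≤ p) (h : μ + ν = volume) {t : ℝ}
    (hm : μ.real (Set.Iic t) = 1 / 2) :
    TransportsInto p (μ.restrict (Set.Iic t)) (ν.restrict (Set.Iic t))
      (ENNReal.ofReal ((1 / 2) ^ p * (1 / 2 - μ.real (Set.Iic (t - 1 / 2)) ^ 2 / 8))) := by
  have hac : μ ≪ volume := (le_volume_of_add_eq h).absolutelyContinuous
  have hac' : ν ≪ volume := (le_volume_of_add_eq (by rw [add_comm, h])).absolutelyContinuous
  have hinv : ∀ κ : Measure ℝ, (κ.map Neg.neg).map Neg.neg = κ := fun κ => by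
    rw [Measure.map_map measurable_neg measurable_neg, neg_comp_neg, Measure.map_id]
  have hreal : ∀ a, (μ.map Neg.neg).real (Set.Ioi a) = μ.real (Set.Iic (-a)) := by
    intro a
    rw [measureReal_def, measureReal_def, Measure.map_apply measurable_neg measurableSet_Ioi]
    congr 1
    rw [measure_congr (Iio_ae_eq_Iic' (a := -a) (hac (by simp))).symm]
    congr 1
    ext x; simp
  have hres : ∀ κ : Measure ℝ, κ ≪ volume →
      ((κ.map Neg.neg).restrict (Set.Ioi (-t))).map Neg.neg = κ.restrict (Set.Iic t) := by
    intro κ hκ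
    have : Set.Ioi (-t) = Neg.neg ⁻¹' (Set.Iio t) := by ext x; simp
    rw [this, ← Measure.restrict_map measurable_neg measurableSet_Iio, hinv]
    exact Measure.restrict_congr_set (Iio_ae_eq_Iic' (hκ (by simp)))
  have key := (transportsInto_Ioi_half (μ := μ.map Neg.neg) (ν := ν.map Neg.neg) (t := -t) hp
    (by rw [← Measure.map_add _ _ measurable_neg, h]
        exact Measure.map_neg_eq_self volume)
    (by rw [hreal, neg_neg, hm])).map_neg
  have ht : -(-t + 1 / 2) = t - 1 / 2 := by ring
  rwa [hres μ hac, hres ν hac', hreal, ht] at key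

/-- A probability measure below Lebesgue measure is transported into its complement at cost
`(1 / 2) ^ p`, up to a gain quadratic in the mass outside the unit interval around its median. -/
lemma exists_transportsInto [IsProbabilityMeasure μ] (hp : 1 ≤ p) (h : μ + ν = volume) :
    ∃ t, TransportsInto p μ ν (ENNReal.ofReal ((1 / 2) ^ p *
      (1 - (μ.real (Set.Iic (t - 1 / 2)) + μ.real (Set.Ioi (t + 1 / 2))) ^ 2 / 16))) := by
  have hμ := le_volume_of_add_eq h
  obtain ⟨y, hy⟩ : ∃ y, 1 / 2 < μ.real (Set.Iic y) := by
    refine ((tendsto_measureReal_Iic_atTop (μ := μ)).eventually_const_lt ?_).exists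
    rw [probReal_univ]; norm_num
  obtain ⟨t, -, ht⟩ := exists_measureReal_Iic_eq hμ (by norm_num : (0 : ℝ) < 1 / 2) hy.le
  have ht' : μ.real (Set.Ioi t) = 1 / 2 := by
    rw [← Set.compl_Iic, probReal_compl_eq_one_sub measurableSet_Iic, ht]; norm_num
  refine ⟨t, ?_⟩
  have hd : Disjoint (Set.Iic t) (Set.Ioi t) := Set.Iic_disjoint_Ioi le_rfl
  have key := (transportsInto_Iic_half hp h ht).union hd measurableSet_Ioi
    (transportsInto_Ioi_half hp h ht')
  rw [Set.Iic_union_Ioi, Measure.restrict_univ, Measure.restrict_univ] at key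
  have hM : 0 < (1 / 2 : ℝ) ^ p := by positivity
  have ha : μ.real (Set.Iic (t - 1 / 2)) ≤ 1 := measureReal_le_one
  have hb : μ.real (Set.Ioi (t + 1 / 2)) ≤ 1 := measureReal_le_one
  have ha0 : 0 ≤ μ.real (Set.Iic (t - 1 / 2)) := measureReal_nonneg
  have hb0 : 0 ≤ μ.real (Set.Ioi (t + 1 / 2)) := measureReal_nonneg
  rw [← ENNReal.ofReal_add (mul_nonneg hM.le (by nlinarith)) (mul_nonneg hM.le (by nlinarith)),
    ← mul_add] at key
  refine key.mono (ENNReal.ofReal_le_ofReal (mul_le_mul_of_nonneg_left ?_ hM.le))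
  nlinarith [sq_nonneg (μ.real (Set.Iic (t - 1 / 2)) - μ.real (Set.Ioi (t + 1 / 2)))]

end Line

/-! ### Bounds on the energy -/

section Energy

variable {p : ℝ} {ρ : ℝ → ℝ}

lemma densityMeasure_univ {ρ : ℝ → ℝ} (hi : Integrable ρ) (h0 : ∀ᵐ x, 0 ≤ ρ x) :
    densityMeasure ρ Set.univ = ENNReal.ofReal (∫ x, ρ x) := by
  rw [densityMeasure, withDensity_apply _ MeasurableSet.univ, Measure.restrict_univ,
    ofReal_integral_eq_lintegral_ofReal hi h0]

lemma densityMeasure_add_compl (hi : Integrable ρ) (h0 : ∀ᵐ x, 0 ≤ ρ x) (h1 : ∀ᵐ x, ρ x ≤ 1) :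
    densityMeasure ρ + densityMeasure (fun x => 1 - ρ x) = volume := by
  ext s hs
  rw [Measure.add_apply, densityMeasure, densityMeasure, withDensity_apply _ hs,
    withDensity_apply _ hs, ← lintegral_add_left' hi.aemeasurable.ennreal_ofReal.restrict]
  have : ∀ᵐ x ∂volume.restrict s, ENNReal.ofReal (ρ x) + ENNReal.ofReal (1 - ρ x) = 1 := by
    filter_upwards [ae_restrict_of_ae h0, ae_restrict_of_ae h1] with x hx0 hx1
    rw [← ENNReal.ofReal_add hx0 (by linarith), add_sub_cancel, ENNReal.ofReal_one]
  rw [lintegral_congr_ae this, setLIntegral_one]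

/-- A transport into the free space bounds the energy: the competitor is the density of the second
marginal. -/
lemma wassersteinEnergy_rpow_le (hp : 0 < p) (hi : Integrable ρ) (h0 : ∀ᵐ x, 0 ≤ ρ x)
    (h1 : ∀ᵐ x, ρ x ≤ 1) {c : ℝ≥0∞}
    (h : TransportsInto p (densityMeasure ρ) (densityMeasure fun x => 1 - ρ x) c) :
    wassersteinEnergy p ρ ^ p ≤ c := by
  obtain ⟨π, hπ1, hπ2, hπ3⟩ := h
  set κ := π.map Prod.snd with hκ
  have hac : κ ≪ volume :=
    (hπ2.trans (le_volume_of_add_eq (by rw [add_comm, densityMeasure_add_compl hi h0 h1])))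
      |>.absolutelyContinuous
  have hu : κ Set.univ = ENNReal.ofReal (∫ x, ρ x) := by
    rw [← densityMeasure_univ hi h0, ← hπ1, hκ, Measure.map_apply measurable_snd .univ,
      Measure.map_apply measurable_fst .univ, Set.preimage_univ, Set.preimage_univ]
  have : IsFiniteMeasure κ := ⟨by rw [hu]; exact ENNReal.ofReal_lt_top⟩
  have hle : κ.rnDeriv volume ≤ᵐ[volume] fun x => ENNReal.ofReal (1 - ρ x) := by
    refine ae_le_of_forall_setLIntegral_le_of_sigmaFinite (Measure.measurable_rnDeriv _ _)
      fun s hs _ => ?_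
    rw [Measure.setLIntegral_rnDeriv hac, ← withDensity_apply _ hs]
    exact hπ2 s
  have hdens : densityMeasure (fun x => (κ.rnDeriv volume x).toReal) = κ := by
    conv_rhs => rw [← Measure.withDensity_rnDeriv_eq κ volume hac]
    refine withDensity_congr_ae ?_
    filter_upwards [κ.rnDeriv_lt_top volume] with x hx
    exact ENNReal.ofReal_toReal hx.ne
  have hmem : (fun x => (κ.rnDeriv volume x).toReal) ∈ {ρ' : ℝ → ℝ | Integrable ρ' ∧
      (∀ᵐ x, 0 ≤ ρ' x) ∧ (∀ᵐ x, ρ x + ρ' x ≤ 1) ∧ ∫ x, ρ' x = ∫ x, ρ x} := by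
    refine ⟨Measure.integrable_toReal_rnDeriv, .of_forall fun _ => ENNReal.toReal_nonneg, ?_, ?_⟩
    · filter_upwards [hle, h1] with x hx hx1
      have := ENNReal.toReal_mono ENNReal.ofReal_ne_top hx
      rw [ENNReal.toReal_ofReal (by linarith)] at this
      linarith
    · rw [Measure.integral_toReal_rnDeriv hac, measureReal_def, hu,
        ENNReal.toReal_ofReal (integral_nonneg_of_ae h0)]
  calc wassersteinEnergy p ρ ^ p
      ≤ (wassersteinDist p (densityMeasure ρ) κ) ^ p := by
        refine ENNReal.rpow_le_rpow ((biInf_le _ hmem).trans (le_of_eq ?_)) hp.le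
        rw [hdens]
    _ = transportCost p (densityMeasure ρ) κ := by
        rw [wassersteinDist, one_div p, ENNReal.rpow_inv_rpow hp.ne']
    _ ≤ ∫⁻ z, edist z.1 z.2 ^ p ∂π := iInf₂_le π (show _ ∧ _ from ⟨hπ1, hκ.symm⟩)
    _ ≤ c := hπ3

/-- The `1`-Lipschitz potential `(1 - |y - c|)⁺` that certifies the energy of the unit interval
centred at `c`. -/
noncomputable def tentPotential (c y : ℝ) : ℝ := max (1 - |y - c|) 0

lemma tentPotential_nonneg (c y : ℝ) : 0 ≤ tentPotential c y := le_max_right _ _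

lemma continuous_tentPotential (c : ℝ) : Continuous (tentPotential c) := by
  unfold tentPotential; fun_prop

lemma ofReal_tentPotential_le (c x y : ℝ) :
    ENNReal.ofReal (tentPotential c x) ≤ edist x y + ENNReal.ofReal (tentPotential c y) := by
  rw [edist_dist, ← ENNReal.ofReal_add dist_nonneg (tentPotential_nonneg c y)]
  refine ENNReal.ofReal_le_ofReal (max_le ?_ (add_nonneg dist_nonneg (tentPotential_nonneg c y)))
  have h1 := abs_sub_le y x c
  have h2 : 1 - |y - c| ≤ tentPotential c y := le_max_left _ _
  rw [Real.dist_eq, abs_sub_comm x y]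
  linarith

/-- The tangent line of `t ↦ t ^ p` at `1 / 2`. -/
lemma tangent_le_edist_rpow (hp : 1 ≤ p) (x y : ℝ) :
    ENNReal.ofReal ((1 / 2) ^ p * (2 * p)) * edist x y ≤
      edist x y ^ p + ENNReal.ofReal ((1 / 2) ^ p * (p - 1)) := by
  have hM : 0 < (1 / 2 : ℝ) ^ p := by positivity
  have hd := dist_nonneg (x := x) (y := y)
  rw [edist_dist, ENNReal.ofReal_rpow_of_nonneg hd (by linarith),
    ← ENNReal.ofReal_mul (by positivity), ← ENNReal.ofReal_add (by positivity)
      (mul_nonneg hM.le (by linarith))]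
  refine ENNReal.ofReal_le_ofReal ?_
  have h := one_add_mul_self_le_rpow_one_add (by linarith : -1 ≤ 2 * dist x y - 1) hp
  have he : dist x y ^ p = (1 / 2) ^ p * (1 + (2 * dist x y - 1)) ^ p := by
    rw [← Real.mul_rpow (by norm_num) (by linarith)]; congr 1; ring
  rw [he]
  have := mul_le_mul_of_nonneg_left h hM.le
  linarith

lemma integrable_tentPotential (c : ℝ) : Integrable (tentPotential c) := by
  refine (continuous_tentPotential c).integrable_of_hasCompactSupport ?_
  refine HasCompactSupport.intro (isCompact_Icc (a := c - 1) (b := c + 1)) fun y hy => ?_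
  refine max_eq_right ?_
  by_contra! h
  have := abs_lt.1 (by linarith : |y - c| < 1)
  exact hy ⟨by linarith, by linarith⟩

lemma integrable_tentPotential_mul (c : ℝ) (hi : Integrable ρ) (h0 : ∀ᵐ x, 0 ≤ ρ x)
    (h1 : ∀ᵐ x, ρ x ≤ 1) : Integrable fun y => tentPotential c y * ρ y := by
  refine (integrable_tentPotential c).mono
    ((continuous_tentPotential c).aestronglyMeasurable.mul hi.aestronglyMeasurable) ?_
  filter_upwards [h0, h1] with y hy0 hy1
  rw [norm_mul, Real.norm_eq_abs (ρ y), abs_of_nonneg hy0]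
  exact mul_le_of_le_one_right (norm_nonneg _) hy1

lemma lintegral_tentPotential_densityMeasure (c : ℝ) (hi : Integrable ρ) (h0 : ∀ᵐ x, 0 ≤ ρ x)
    (h1 : ∀ᵐ x, ρ x ≤ 1) :
    ∫⁻ y, ENNReal.ofReal (tentPotential c y) ∂densityMeasure ρ =
      ENNReal.ofReal (∫ y, tentPotential c y * ρ y) := by
  rw [densityMeasure, lintegral_withDensity_eq_lintegral_mul₀ hi.aemeasurable.ennreal_ofReal
    (continuous_tentPotential c).measurable.ennreal_ofReal.aemeasurable,
    ofReal_integral_eq_lintegral_ofReal]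
  · refine lintegral_congr fun y => ?_
    rw [Pi.mul_apply, mul_comm, ENNReal.ofReal_mul (tentPotential_nonneg c y)]
  · exact integrable_tentPotential_mul c hi h0 h1
  · filter_upwards [h0] with y hy using mul_nonneg (tentPotential_nonneg c y) hy

/-- Kantorovich duality with the tent potential bounds the mean displacement of any competitor from
below by `w`, and the tangent line of `t ↦ t ^ p` at `1 / 2` turns this into a bound on the cost. -/
lemma le_wassersteinEnergy_rpow (hp : 1 ≤ p) (hρ : ρ ∈ admissibleDensities ℝ 1) (c : ℝ) {w : ℝ}
    (hw : w ≤ (∫ y, tentPotential c y * ρ y) - ∫ y, tentPotential c y * (1 - ρ y)) :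
    ENNReal.ofReal ((1 / 2) ^ p * (2 * p * w - (p - 1))) ≤ wassersteinEnergy p ρ ^ p := by
  obtain ⟨hi, h0, h1, hint⟩ := hρ
  have hp0 : 0 < p := by linarith
  have hM : 0 < (1 / 2 : ℝ) ^ p := by positivity
  rw [← ENNReal.rpow_inv_le_iff hp0]
  refine le_iInf₂ fun ρ' ⟨hi', h0', hle', hint'⟩ => ?_
  rw [wassersteinDist, one_div p]
  refine ENNReal.rpow_le_rpow ?_ (by positivity)
  refine le_iInf₂ fun π hπ => ?_
  obtain ⟨hπ1, hπ2⟩ := hπ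
  have hφ : Measurable fun y => ENNReal.ofReal (tentPotential c y) :=
    (continuous_tentPotential c).measurable.ennreal_ofReal
  have h1' : ∀ᵐ x, ρ' x ≤ 1 := by filter_upwards [h0, hle'] with x _ _; linarith
  have hprob : π Set.univ = 1 := by
    have := densityMeasure_univ hi h0
    rwa [← hπ1, Measure.map_apply measurable_fst .univ, Set.preimage_univ, hint,
      ENNReal.ofReal_one] at this
  have hdual : ENNReal.ofReal (∫ y, tentPotential c y * ρ y) ≤
      ∫⁻ z, edist z.1 z.2 ∂π + ENNReal.ofReal (∫ y, tentPotential c y * (1 - ρ y)) := by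
    have hcompl : Integrable fun y => tentPotential c y * (1 - ρ y) := by
      simp_rw [mul_sub, mul_one]
      exact (integrable_tentPotential c).sub (integrable_tentPotential_mul c hi h0 h1)
    have hρ' : ∫ y, tentPotential c y * ρ' y ≤ ∫ y, tentPotential c y * (1 - ρ y) := by
      refine integral_mono_ae (integrable_tentPotential_mul c hi' h0' h1') hcompl ?_
      filter_upwards [hle'] with y hy
      exact mul_le_mul_of_nonneg_left (by linarith) (tentPotential_nonneg c y)
    calc ENNReal.ofReal (∫ y, tentPotential c y * ρ y)
        = ∫⁻ z, ENNReal.ofReal (tentPotential c z.1) ∂π := by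
          rw [← lintegral_tentPotential_densityMeasure c hi h0 h1, ← hπ1,
            lintegral_map hφ measurable_fst]
      _ ≤ ∫⁻ z, (edist z.1 z.2 + ENNReal.ofReal (tentPotential c z.2)) ∂π :=
          lintegral_mono fun z => ofReal_tentPotential_le c z.1 z.2
      _ = ∫⁻ z, edist z.1 z.2 ∂π + ENNReal.ofReal (∫ y, tentPotential c y * ρ' y) := by
          rw [lintegral_add_left (by fun_prop),
            ← lintegral_tentPotential_densityMeasure c hi' h0' h1', ← hπ2,
            lintegral_map hφ measurable_snd]
      _ ≤ _ := by gcongr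
  have hmean : ENNReal.ofReal w ≤ ∫⁻ z, edist z.1 z.2 ∂π := by
    refine (ENNReal.ofReal_le_ofReal hw).trans ?_
    rw [ENNReal.ofReal_sub]
    · exact tsub_le_iff_right.2 hdual
    · refine integral_nonneg_of_ae ?_
      filter_upwards [h1] with y hy using mul_nonneg (tentPotential_nonneg c y) (by linarith)
  have htan : ENNReal.ofReal ((1 / 2) ^ p * (2 * p)) * ∫⁻ z, edist z.1 z.2 ∂π ≤
      ∫⁻ z, edist z.1 z.2 ^ p ∂π + ENNReal.ofReal ((1 / 2) ^ p * (p - 1)) := by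
    rw [← lintegral_const_mul _ (by fun_prop)]
    refine (lintegral_mono fun z : ℝ × ℝ => tangent_le_edist_rpow hp z.1 z.2).trans
      (le_of_eq ?_)
    rw [lintegral_add_right _ measurable_const, lintegral_const, hprob, mul_one]
  have hsplit : (1 / 2 : ℝ) ^ p * (2 * p * w - (p - 1)) =
      (1 / 2) ^ p * (2 * p) * w - (1 / 2) ^ p * (p - 1) := by ring
  rw [hsplit, ENNReal.ofReal_sub _ (mul_nonneg hM.le (by linarith)), tsub_le_iff_right,
    ENNReal.ofReal_mul (by positivity)]
  exact (mul_le_mul_right hmean _).trans htan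

end Energy

/-! ### The asymmetry -/

section Asymmetry

variable {ρ : ℝ → ℝ}

lemma volume_ball_eq_one_iff (x r : ℝ) : volume (Metric.ball x r) = 1 ↔ r = 1 / 2 := by
  rw [Real.volume_ball]
  constructor
  · intro h
    rw [ENNReal.ofReal_eq_one] at h
    linarith
  · rintro rfl
    norm_num

lemma indicator_mem_admissibleDensities {s : Set ℝ} (hs : MeasurableSet s) (h1 : volume s = 1) :
    s.indicator (fun _ => (1 : ℝ)) ∈ admissibleDensities ℝ 1 := by
  refine ⟨?_, .of_forall fun x => ?_, .of_forall fun x => ?_, ?_⟩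
  · exact (integrable_indicator_iff hs).2 (integrableOn_const (by simp [h1]))
  · exact Set.indicator_nonneg (fun _ _ => zero_le_one) x
  · exact Set.indicator_le_self' (fun _ _ => zero_le_one) x
  · rw [integral_indicator hs]; simp [Measure.real, h1]

lemma asymmetry_nonneg (ρ : ℝ → ℝ) : 0 ≤ asymmetry ρ := by
  refine Real.sInf_nonneg ?_
  rintro _ ⟨x, r, -, rfl⟩
  exact integral_nonneg fun _ => abs_nonneg _

lemma asymmetry_le (hρ : ρ ∈ admissibleDensities ℝ 1) (t : ℝ) :
    asymmetry ρ ≤ 2 * (1 - ∫ y in Metric.ball t (1 / 2), ρ y) := by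
  have hball := (volume_ball_eq_one_iff t (1 / 2)).2 rfl
  obtain ⟨hi, h0, h1, hint⟩ := hρ
  obtain ⟨hbi, -, -, hbint⟩ := indicator_mem_admissibleDensities Metric.isOpen_ball.measurableSet
    hball
  have hle : asymmetry ρ ≤ ∫ y, |ρ y - ballDensity t (1 / 2) y| :=
    csInf_le ⟨0, by rintro _ ⟨x, r, -, rfl⟩; exact integral_nonneg fun _ => abs_nonneg _⟩
      ⟨t, 1 / 2, hball, rfl⟩
  refine hle.trans (le_of_eq ?_)
  have hpt : ∀ᵐ y, |ρ y - ballDensity t (1 / 2) y| =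
      ρ y + (Metric.ball t (1 / 2)).indicator (fun _ => (1 : ℝ)) y -
        2 * (Metric.ball t (1 / 2)).indicator ρ y := by
    filter_upwards [h0, h1] with y hy0 hy1
    by_cases hy : y ∈ Metric.ball t (1 / 2)
    · simp only [ballDensity, Set.indicator_of_mem hy]
      rw [abs_of_nonpos (by linarith)]; ring
    · simp only [ballDensity, Set.indicator_of_notMem hy]
      rw [abs_of_nonneg (by linarith)]; ring
  have hind := hi.indicator (Metric.isOpen_ball (x := t) (ε := 1 / 2)).measurableSet
  have hsub := integral_sub (hi.add hbi) (hind.const_mul 2)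
  have hadd := integral_add hi hbi
  simp only [Pi.add_apply] at hsub hadd
  rw [integral_congr_ae hpt, hsub, hadd, hint, hbint, integral_const_mul,
    integral_indicator Metric.isOpen_ball.measurableSet]
  ring

end Asymmetry

/-! ### The perturbed interval -/

section Perturbed

/-- The interval `(c - 1/2, c + 1/2)`, whose last piece of length `ε` is moved to the right
by `ε`. -/
def perturbedInterval (c ε : ℝ) : Set ℝ :=
  Set.Ioo (c - 1 / 2) (c + 1 / 2 - ε) ∪ Set.Ioo (c + 1 / 2) (c + 1 / 2 + ε)

lemma measurableSet_perturbedInterval (c ε : ℝ) : MeasurableSet (perturbedInterval c ε) :=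
  measurableSet_Ioo.union measurableSet_Ioo

lemma perturbedInterval_zero (c : ℝ) : perturbedInterval c 0 = Metric.ball c (1 / 2) := by
  simp [perturbedInterval, Real.ball_eq_Ioo]

variable {c ε : ℝ}

lemma disjoint_perturbedInterval (hε : 0 ≤ ε) :
    Disjoint (Set.Ioo (c - 1 / 2) (c + 1 / 2 - ε)) (Set.Ioo (c + 1 / 2) (c + 1 / 2 + ε)) :=
  Set.disjoint_left.2 fun y h1 h2 => by linarith [h1.2, h2.1]

lemma volume_perturbedInterval (hε : 0 ≤ ε) (hε1 : ε ≤ 1) :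
    volume (perturbedInterval c ε) = 1 := by
  rw [perturbedInterval, measure_union (disjoint_perturbedInterval hε) measurableSet_Ioo,
    Real.volume_Ioo, Real.volume_Ioo, ← ENNReal.ofReal_add (by linarith) (by linarith),
    ENNReal.ofReal_eq_one]
  ring

lemma integral_affine (k s a b : ℝ) :
    ∫ y in a..b, (k + s * y) = k * (b - a) + s * ((b ^ 2 - a ^ 2) / 2) := by
  rw [intervalIntegral.integral_add (by simp) (Continuous.intervalIntegrable (by fun_prop) _ _),
    intervalIntegral.integral_const_mul, integral_id, intervalIntegral.integral_const, smul_eq_mul,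
    mul_comm]

lemma integral_tentPotential_right {a b : ℝ} (ha : c ≤ a) (hab : a ≤ b) (hb : b ≤ c + 1) :
    ∫ y in a..b, tentPotential c y = (1 + c) * (b - a) + -1 * ((b ^ 2 - a ^ 2) / 2) := by
  rw [← integral_affine]
  refine intervalIntegral.integral_congr fun y hy => ?_
  rw [Set.uIcc_of_le hab] at hy
  simp only [tentPotential]
  rw [abs_of_nonneg (by linarith [hy.1]), max_eq_left (by linarith [hy.2])]
  ring

lemma integral_tentPotential_left {a b : ℝ} (ha : c - 1 ≤ a) (hab : a ≤ b) (hb : b ≤ c) :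
    ∫ y in a..b, tentPotential c y = (1 - c) * (b - a) + 1 * ((b ^ 2 - a ^ 2) / 2) := by
  rw [← integral_affine]
  refine intervalIntegral.integral_congr fun y hy => ?_
  rw [Set.uIcc_of_le hab] at hy
  simp only [tentPotential]
  rw [abs_of_nonpos (by linarith [hy.2]), max_eq_left (by linarith [hy.1])]
  ring

lemma intervalIntegrable_tentPotential (c a b : ℝ) :
    IntervalIntegrable (tentPotential c) volume a b :=
  (continuous_tentPotential c).intervalIntegrable _ _

lemma integral_tentPotential (c : ℝ) : ∫ y, tentPotential c y = 1 := by
  have hsupp : Function.support (tentPotential c) ⊆ Set.Ioc (c - 1) (c + 1) := by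
    intro y hy
    by_contra h
    refine hy (max_eq_right ?_)
    by_contra! h'
    have := abs_lt.1 (by linarith : |y - c| < 1)
    exact h ⟨by linarith, by linarith⟩
  rw [← intervalIntegral.integral_eq_integral_of_support_subset hsupp,
    ← intervalIntegral.integral_add_adjacent_intervals
      (intervalIntegrable_tentPotential c (c - 1) c) (intervalIntegrable_tentPotential c c (c + 1)),
    integral_tentPotential_left le_rfl (by linarith) le_rfl,
    integral_tentPotential_right le_rfl (by linarith) le_rfl]
  ring

lemma setIntegral_tentPotential_perturbedInterval (hε : 0 ≤ ε) (hε1 : ε ≤ 1 / 2) :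
    ∫ y in perturbedInterval c ε, tentPotential c y = 3 / 4 - ε ^ 2 := by
  have hi := integrable_tentPotential c
  rw [perturbedInterval, setIntegral_union (disjoint_perturbedInterval hε) measurableSet_Ioo
    hi.integrableOn hi.integrableOn, ← integral_Ioc_eq_integral_Ioo, ← integral_Ioc_eq_integral_Ioo,
    ← intervalIntegral.integral_of_le (by linarith), ← intervalIntegral.integral_of_le (by linarith),
    ← intervalIntegral.integral_add_adjacent_intervals
      (intervalIntegrable_tentPotential c (c - 1 / 2) c) (intervalIntegrable_tentPotential c c _),
    integral_tentPotential_left (by linarith) (by linarith) le_rfl,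
    integral_tentPotential_right le_rfl (by linarith) (by linarith),
    integral_tentPotential_right (by linarith) (by linarith) (by linarith)]
  ring

/-- Moving a piece of length `ε` of the interval by `ε` lowers the energy by `O(ε ^ 2)` only. -/
lemma le_wassersteinEnergy_perturbedInterval {p : ℝ} (hp : 1 ≤ p) (hε : 0 ≤ ε) (hε1 : ε ≤ 1 / 2) :
    ENNReal.ofReal ((1 / 2) ^ p * (1 - 4 * p * ε ^ 2)) ≤
      wassersteinEnergy p ((perturbedInterval c ε).indicator fun _ => (1 : ℝ)) ^ p := by
  have hs := measurableSet_perturbedInterval c ε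
  have hρ := indicator_mem_admissibleDensities hs
    (volume_perturbedInterval (c := c) hε (by linarith))
  have hmul : ∀ y, tentPotential c y * (perturbedInterval c ε).indicator (fun _ => (1 : ℝ)) y =
      (perturbedInterval c ε).indicator (tentPotential c) y := by
    intro y
    by_cases hy : y ∈ perturbedInterval c ε <;> simp [hy]
  have hi := integrable_tentPotential c
  have key := le_wassersteinEnergy_rpow hp hρ c (w := 1 / 2 - 2 * ε ^ 2) (by
    simp_rw [mul_sub, mul_one, hmul]
    rw [integral_sub hi (hi.indicator hs), integral_indicator hs,
      setIntegral_tentPotential_perturbedInterval hε hε1, integral_tentPotential]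
    linarith)
  have he : 2 * p * (1 / 2 - 2 * ε ^ 2) - (p - 1) = 1 - 4 * p * ε ^ 2 := by ring
  rwa [he] at key

lemma asymmetry_perturbedInterval_le (hε : 0 ≤ ε) (hε1 : ε ≤ 1 / 2) :
    asymmetry ((perturbedInterval c ε).indicator fun _ => (1 : ℝ)) ≤ 2 * ε := by
  have hs := measurableSet_perturbedInterval c ε
  have hρ := indicator_mem_admissibleDensities hs
    (volume_perturbedInterval (c := c) hε (by linarith))
  have hle := asymmetry_le hρ c
  have hsub : Set.Ioo (c - 1 / 2) (c + 1 / 2 - ε) ⊆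
      Metric.ball c (1 / 2) ∩ perturbedInterval c ε := fun y hy => by
    rw [Real.ball_eq_Ioo]
    exact ⟨⟨hy.1, by linarith [hy.2]⟩, Or.inl hy⟩
  have hfin : volume (Metric.ball c (1 / 2) ∩ perturbedInterval c ε) ≠ ∞ :=
    measure_ne_top_of_subset Set.inter_subset_left (by simp)
  have hge := measureReal_mono (μ := volume) hsub hfin
  rw [measureReal_def, Real.volume_Ioo, ENNReal.toReal_ofReal (by linarith)] at hge
  rw [setIntegral_indicator hs, setIntegral_const, smul_eq_mul, mul_one] at hle
  linarith

/-- The points `y` and `y + 1` of the two extreme pieces of length `ε` are never in the same open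
interval of length one. -/
lemma le_asymmetry_perturbedInterval (hε : 0 ≤ ε) (hε1 : ε ≤ 1 / 2) :
    ε ≤ asymmetry ((perturbedInterval c ε).indicator fun _ => (1 : ℝ)) := by
  have hs := measurableSet_perturbedInterval c ε
  refine le_csInf ⟨_, c, 1 / 2, (volume_ball_eq_one_iff c _).2 rfl, rfl⟩ ?_
  rintro _ ⟨x, r, hr, rfl⟩
  have hr' := (volume_ball_eq_one_iff x r).1 hr
  obtain ⟨hi, -⟩ := indicator_mem_admissibleDensities hs
    (volume_perturbedInterval (c := c) hε (by linarith))
  obtain ⟨hbi, -⟩ := indicator_mem_admissibleDensities Metric.isOpen_ball.measurableSet hr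
  set f : ℝ → ℝ :=
    fun y => |(perturbedInterval c ε).indicator (fun _ => (1 : ℝ)) y - ballDensity x r y| with hf
  have hfi : Integrable f := (hi.sub hbi).abs
  have hf0 : ∀ y, 0 ≤ f y := fun y => abs_nonneg _
  have hd : Disjoint (Set.Ioc (c - 1 / 2) (c - 1 / 2 + ε)) (Set.Ioc (c + 1 / 2) (c + 1 / 2 + ε)) :=
    Set.Ioc_disjoint_Ioc_of_le (by linarith)
  have hpt : ∀ y ∈ Set.Ioo (c - 1 / 2) (c - 1 / 2 + ε), 1 ≤ f y + f (y + 1) := by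
    intro y hy
    have h1 : y ∈ perturbedInterval c ε := Or.inl ⟨hy.1, by linarith [hy.2]⟩
    have h2 : y + 1 ∈ perturbedInterval c ε := Or.inr ⟨by linarith [hy.1], by linarith [hy.2]⟩
    have h3 : y ∉ Metric.ball x r ∨ y + 1 ∉ Metric.ball x r := by
      rw [Real.ball_eq_Ioo, hr']
      by_contra! h
      linarith [h.1.1, h.2.2]
    have hy0 := hf0 y
    have hy1 := hf0 (y + 1)
    rcases h3 with h3 | h3
    · have : f y = 1 := by simp [hf, ballDensity, h1, h3]
      linarith
    · have : f (y + 1) = 1 := by simp [hf, ballDensity, h2, h3]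
      linarith
  have hshift : ∫ y in (c + 1 / 2)..(c + 1 / 2 + ε), f y =
      ∫ y in (c - 1 / 2)..(c - 1 / 2 + ε), f (y + 1) := by
    rw [intervalIntegral.integral_comp_add_right]
    congr 1 <;> ring
  have hint1 : IntervalIntegrable f volume (c - 1 / 2) (c - 1 / 2 + ε) := hfi.intervalIntegrable
  have hint2 : IntervalIntegrable (fun y => f (y + 1)) volume (c - 1 / 2) (c - 1 / 2 + ε) :=
    (hfi.comp_add_right 1).intervalIntegrable
  calc ε = ∫ _ in (c - 1 / 2)..(c - 1 / 2 + ε), (1 : ℝ) := by simp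
    _ ≤ ∫ y in (c - 1 / 2)..(c - 1 / 2 + ε), (f y + f (y + 1)) :=
        intervalIntegral.integral_mono_on_of_le_Ioo (by linarith) (by simp) (hint1.add hint2) hpt
    _ = (∫ y in Set.Ioc (c - 1 / 2) (c - 1 / 2 + ε), f y) +
          ∫ y in Set.Ioc (c + 1 / 2) (c + 1 / 2 + ε), f y := by
        rw [intervalIntegral.integral_add hint1 hint2, ← hshift,
          intervalIntegral.integral_of_le (by linarith),
          intervalIntegral.integral_of_le (by linarith)]
    _ = ∫ y in Set.Ioc (c - 1 / 2) (c - 1 / 2 + ε) ∪ Set.Ioc (c + 1 / 2) (c + 1 / 2 + ε), f y :=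
        (setIntegral_union hd measurableSet_Ioc hfi.integrableOn hfi.integrableOn).symm
    _ ≤ ∫ y, f y := setIntegral_le_integral hfi (.of_forall hf0)

end Perturbed

/-! ### Stability and sharpness -/

/-- The upper bound on the energy in terms of the mass `e` outside the unit interval around a median
of `ρ`; that interval is a competitor in the asymmetry, at `L¹` distance `2 * e`. -/
lemma exists_wassersteinEnergy_rpow_le {p : ℝ} (hp : 1 ≤ p) {ρ : ℝ → ℝ}
    (hρ : ρ ∈ admissibleDensities ℝ 1) : ∃ e : ℝ, asymmetry ρ ^ 2 ≤ 4 * e ^ 2 ∧ e ^ 2 ≤ 1 ∧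
      wassersteinEnergy p ρ ^ p ≤ ENNReal.ofReal ((1 / 2) ^ p * (1 - e ^ 2 / 16)) := by
  have hA := fun t => asymmetry_le hρ t
  have hA0 := asymmetry_nonneg ρ
  obtain ⟨hi, h0, h1, hint⟩ := hρ
  set μ := densityMeasure ρ with hμ
  have hsum := densityMeasure_add_compl hi h0 h1
  have : IsProbabilityMeasure μ := ⟨by rw [hμ, densityMeasure_univ hi h0, hint, ENNReal.ofReal_one]⟩
  obtain ⟨t, htr⟩ := exists_transportsInto (μ := μ) hp hsum
  have hac : μ ≪ volume := (le_volume_of_add_eq hsum).absolutelyContinuous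
  set e := μ.real (Set.Iic (t - 1 / 2)) + μ.real (Set.Ioi (t + 1 / 2)) with he
  have he0 : 0 ≤ e := by positivity
  have hball : ∫ y in Metric.ball t (1 / 2), ρ y = μ.real (Metric.ball t (1 / 2)) := by
    rw [measureReal_def, hμ, densityMeasure, withDensity_apply _ Metric.isOpen_ball.measurableSet,
      ← ofReal_integral_eq_lintegral_ofReal hi.integrableOn (ae_restrict_of_ae h0),
      ENNReal.toReal_ofReal (integral_nonneg_of_ae (ae_restrict_of_ae h0))]
  have hIoc : μ.real (Metric.ball t (1 / 2)) = μ.real (Set.Ioc (t - 1 / 2) (t + 1 / 2)) := by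
    rw [Real.ball_eq_Ioo]
    exact measureReal_congr (Ioo_ae_eq_Ioc' (hac (by simp)))
  have hdec : μ.real (Set.Ioc (t - 1 / 2) (t + 1 / 2)) = 1 - e := by
    have h2 := measureReal_Iic_sub (μ := μ) (t - 1 / 2) (t + 1 / 2) (by linarith)
    have h3 : μ.real (Set.Ioi (t + 1 / 2)) = 1 - μ.real (Set.Iic (t + 1 / 2)) := by
      rw [← Set.compl_Iic, probReal_compl_eq_one_sub measurableSet_Iic]
    linarith
  have hAe := hA t
  rw [hball, hIoc, hdec] at hAe
  have he1 : e ≤ 1 := by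
    have := measureReal_nonneg (μ := μ) (s := Set.Ioc (t - 1 / 2) (t + 1 / 2))
    linarith
  exact ⟨e, by nlinarith, by nlinarith, wassersteinEnergy_rpow_le (by linarith) hi h0 h1 htr⟩

lemma wassersteinEnergy_rpow_le_half {p : ℝ} (hp : 1 ≤ p) {ρ : ℝ → ℝ}
    (hρ : ρ ∈ admissibleDensities ℝ 1) :
    wassersteinEnergy p ρ ^ p ≤ ENNReal.ofReal ((1 / 2) ^ p) := by
  obtain ⟨e, -, -, he⟩ := exists_wassersteinEnergy_rpow_le hp hρ
  refine he.trans (ENNReal.ofReal_le_ofReal ?_)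
  exact mul_le_of_le_one_right (by positivity) (by linarith [sq_nonneg e])

lemma le_wassersteinEnergy_ballDensity {p : ℝ} (hp : 1 ≤ p) (x : ℝ) :
    ENNReal.ofReal ((1 / 2) ^ p) ≤ wassersteinEnergy p (ballDensity x (1 / 2)) ^ p := by
  have := le_wassersteinEnergy_perturbedInterval (c := x) hp le_rfl (by norm_num)
  rw [perturbedInterval_zero] at this
  simpa [ballDensity] using this

theorem mainTheorem2 (p : ℝ) (hp : 1 < p) :
    -- the energy is finite on the whole class, so that the differences below are meaningful
    (∀ ρ ∈ admissibleDensities ℝ 1, wassersteinEnergy p ρ ≠ ∞) ∧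
    -- the quantitative inequality, for every interval `B` of unit length
    (∃ C : ℝ, 0 < C ∧ ∀ ρ ∈ admissibleDensities ℝ 1, ∀ x r : ℝ,
      volume (Metric.ball x r) = 1 →
        C * asymmetry ρ ^ 2 ≤
          (wassersteinEnergy p (ballDensity x r) ^ p).toReal - (wassersteinEnergy p ρ ^ p).toReal) ∧
    -- sharpness: it fails for every smaller exponent, even for densities of small asymmetry
    (∀ q : ℝ, q < 2 → ∀ c : ℝ, 0 < c → ∀ δ : ℝ, 0 < δ → ∀ x r : ℝ,
      volume (Metric.ball x r) = 1 →
        ∃ ρ ∈ admissibleDensities ℝ 1, 0 < asymmetry ρ ∧ asymmetry ρ < δ ∧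
          (wassersteinEnergy p (ballDensity x r) ^ p).toReal - (wassersteinEnergy p ρ ^ p).toReal <
            c * asymmetry ρ ^ q) := by
  have hp0 : 0 < p := by linarith
  have hM : 0 < (1 / 2 : ℝ) ^ p := by positivity
  have hfin : ∀ ρ ∈ admissibleDensities ℝ 1, wassersteinEnergy p ρ ^ p ≠ ∞ := fun ρ hρ =>
    ne_top_of_le_ne_top ENNReal.ofReal_ne_top (wassersteinEnergy_rpow_le_half hp.le hρ)
  have hball : ∀ x r : ℝ, volume (Metric.ball x r) = 1 →
      ballDensity x r ∈ admissibleDensities ℝ 1 :=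
    fun x r hr => indicator_mem_admissibleDensities Metric.isOpen_ball.measurableSet hr
  refine ⟨fun ρ hρ h => hfin ρ hρ (by rw [h, ENNReal.top_rpow_of_pos hp0]), ?_, ?_⟩
  · refine ⟨(1 / 2) ^ p / 64, by positivity, fun ρ hρ x r hr => ?_⟩
    have hB := hfin _ (hball x r hr)
    obtain rfl := (volume_ball_eq_one_iff x r).1 hr
    have hlow := (ENNReal.ofReal_le_iff_le_toReal hB).1 (le_wassersteinEnergy_ballDensity hp.le x)
    obtain ⟨e, he, he1, hup⟩ := exists_wassersteinEnergy_rpow_le hp.le hρ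
    have hup' := ENNReal.toReal_le_of_le_ofReal (mul_nonneg hM.le (by linarith)) hup
    have := mul_le_mul_of_nonneg_left he hM.le
    linarith
  · intro q hq c hc δ hδ x r hr
    have hup := ENNReal.toReal_le_of_le_ofReal hM.le
      (wassersteinEnergy_rpow_le_half hp.le (hball x r hr))
    have hK : 0 < c / ((1 / 2) ^ p * (4 * p)) := by positivity
    -- the asymmetry lies between `a / 2` and `a`, and the energy deficit is `O(a ^ 2)`
    have hlim : Filter.Tendsto (fun a : ℝ => a ^ (2 - q)) (nhdsWithin 0 (Set.Ioi 0)) (nhds 0) := by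
      have h := (Real.continuousAt_rpow_const 0 (2 - q) (Or.inr (by linarith))).tendsto
      rw [Real.zero_rpow (by linarith)] at h
      exact h.mono_left nhdsWithin_le_nhds
    have hev : ∀ᶠ a : ℝ in nhdsWithin 0 (Set.Ioi 0), a < min δ 1 :=
      nhdsWithin_le_nhds (Iio_mem_nhds (lt_min hδ one_pos))
    obtain ⟨a, ⟨hlt, ha⟩, ha0⟩ :=
      ((hlim.eventually_lt_const hK).and hev |>.and self_mem_nhdsWithin).exists
    replace ha0 : 0 < a := ha0
    obtain ⟨haδ, ha1⟩ := lt_min_iff.1 ha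
    have hε0 : 0 ≤ a / 2 := by linarith
    have hε1 : a / 2 ≤ 1 / 2 := by linarith
    have hρ := indicator_mem_admissibleDensities (measurableSet_perturbedInterval x (a / 2))
      (volume_perturbedInterval (c := x) hε0 (by linarith))
    have hA1 := le_asymmetry_perturbedInterval (c := x) hε0 hε1
    have hA2 := asymmetry_perturbedInterval_le (c := x) hε0 hε1
    have hlow := (ENNReal.ofReal_le_iff_le_toReal (hfin _ hρ)).1
      (le_wassersteinEnergy_perturbedInterval (c := x) hp.le hε0 hε1)
    set A := asymmetry ((perturbedInterval x (a / 2)).indicator fun _ => (1 : ℝ))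
    have hA0 : 0 < A := by linarith
    refine ⟨_, hρ, hA0, by linarith, ?_⟩
    have hAlt : A ^ (2 - q) < c / ((1 / 2) ^ p * (4 * p)) :=
      (Real.rpow_le_rpow hA0.le (by linarith) (by linarith)).trans_lt hlt
    rw [lt_div_iff₀ (by positivity)] at hAlt
    have hAq : 0 < A ^ q := Real.rpow_pos_of_pos hA0 q
    have hsplit : A ^ 2 = A ^ (2 - q) * A ^ q := by
      rw [← Real.rpow_add hA0, sub_add_cancel, Real.rpow_two]
    calc _ ≤ (1 / 2) ^ p * (4 * p) * (a / 2) ^ 2 := by linarith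
      _ ≤ (1 / 2) ^ p * (4 * p) * A ^ 2 := by gcongr
      _ = A ^ (2 - q) * ((1 / 2) ^ p * (4 * p)) * A ^ q := by rw [hsplit]; ring
      _ < c * A ^ q := mul_lt_mul_of_pos_right hAlt hAq
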